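/- Let $K$ be a field of characteristic $0$, let $n\ge 2$, and let $$f_1(x)=\alpha_0x^{n-1}+\alpha_1x^{n-2}+\cdots+\alpha_{n-1},\qquad f_2(x)=\beta_0x^{n-2}+\beta_1x^{n-3}+\cdots+\beta_{n-2}$$ be arbitrary polynomials over $K$ of degrees exactly $n-1$ and $n-2$; put $\alpha_i=0$ for $i>n-1$ and $\beta_i=0$ for $i>n-2$. Define $f_3,f_4,\dots$ by the signed Euclidean algorithm: for $j\ge 2$, as long as $f_j\ne 0$, $f_{j+1}$ is the opposite of the remainder of the Euclidean division of $f_{j-1}$ by $f_j$, i.e. $$f_{j-1}=q_{j-1}f_j-f_{j+1},\qquad \deg f_{j+1}<\deg f_j ;$$ once some $f_j$ is $0$, all later terms are $0$. For $i\ge 0$ put $c(1)_i=\alpha_i/\alpha_0$ and $b(1)_{i+2}=\beta_i$. For $k\ge 2$ and $i\ge 2k$ define recursively $$b(k)_i=b(k-1)_i+c(1)_{k-1}\,b(1)_{i-k+1}-c(1)_{i-k}\,b(1)_k .$$ For $m\ge 2$ and $i\ge 0$ let $C(m)_i$ be the $(m-1)\times(m-1)$ matrix whose entry in row $r$ and column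 $s$ ($1\le r,s\le m-1$) is $b(\min(r,s))_{r+s}$ if $r<m-1$, and $b(s)_{m-1+s+i}$ if $r=m-1$. Put $c(m)_i=\det C(m)_i$ for $m\ge2$, and $c(m)=c(m)_0$ for $m\ge 1$. Finally put $$\tilde\gamma_1=\alpha_0,\qquad \tilde\gamma_2=1,\qquad \tilde\gamma_{j+1}=\tilde\gamma_{j-1}\,\frac{c(j-1)^2}{c(j)^2}\quad (j\ge 2).$$ **Theorem.** Let $1\le j\le n$ and suppose that $\deg f_j=n-j$ (so $f_j\neq0$). Then for every $1\le i\le j$ one has $\deg f_i=n-i$, $c(i)\neq 0$, and $$f_i(x)=\tilde\gamma_i\sum_{p=0}^{n-i}c(i)_p\,x^{n-i-p}.$$ In particular the leading coefficient of $f_i$ is $\tilde\gamma_i\,c(i)$. (By the asserted non-vanishing of the $c(i)$, the numbers $\tilde\gamma_1,\dots,\tilde\gamma_j$ are well defined.) -/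

import Mathlib

open Polynomial

namespace EuclidJacobi

noncomputable section

variable {K : Type*} [Field K]

open Classical in
/-- The signed Euclidean algorithm on `f₁, f₂`, indexed from `1`: for `j ≥ 2`, `f_{j+1}` is the
opposite of the remainder of the division of `f_{j-1}` by `f_j`.  The algorithm stops as soon as
`f_j = 0`; all later terms are then `0`.  (The value at the index `0` is not used.) -/
def remSeq (f₁ f₂ : K[X]) : ℕ → K[X]
  | 0 => 0
  | 1 => f₁
  | 2 => f₂
  | j + 3 => if remSeq f₁ f₂ (j + 2) = 0 then 0
      else -(remSeq f₁ f₂ (j + 1) % remSeq f₁ f₂ (j + 2))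

/-- The defining property of the sequence: `f_{j-1} = q f_j - f_{j+1}`, `deg f_{j+1} < deg f_j`,
as long as `f_j ≠ 0`. -/
theorem remSeq_spec (f₁ f₂ : K[X]) (j : ℕ) (h : remSeq f₁ f₂ (j + 2) ≠ 0) :
    (∃ q : K[X], remSeq f₁ f₂ (j + 1) = q * remSeq f₁ f₂ (j + 2) - remSeq f₁ f₂ (j + 3)) ∧
      (remSeq f₁ f₂ (j + 3)).degree < (remSeq f₁ f₂ (j + 2)).degree := by
  have h3 : remSeq f₁ f₂ (j + 3) = -(remSeq f₁ f₂ (j + 1) % remSeq f₁ f₂ (j + 2)) := by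
    rw [remSeq, if_neg h]
  rw [h3]
  refine ⟨⟨remSeq f₁ f₂ (j + 1) / remSeq f₁ f₂ (j + 2), ?_⟩, ?_⟩
  · have := EuclideanDomain.div_add_mod (remSeq f₁ f₂ (j + 1)) (remSeq f₁ f₂ (j + 2))
    rw [sub_neg_eq_add, mul_comm]
    exact this.symm
  · rw [degree_neg]
    exact EuclideanDomain.mod_lt _ h

/-- The coefficients of `f₁ = α₀ x^{n-1} + α₁ x^{n-2} + ⋯`, with `αᵢ = 0` for `i > n - 1`. -/
def alpha (n : ℕ) (f₁ : K[X]) (i : ℕ) : K :=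
  if i ≤ n - 1 then f₁.coeff (n - 1 - i) else 0

/-- The coefficients of `f₂ = β₀ x^{n-2} + β₁ x^{n-3} + ⋯`, with `βᵢ = 0` for `i > n - 2`. -/
def beta (n : ℕ) (f₂ : K[X]) (i : ℕ) : K :=
  if i ≤ n - 2 then f₂.coeff (n - 2 - i) else 0

/-- `c(1)_i = αᵢ / α₀`. -/
def c1 (n : ℕ) (f₁ : K[X]) (i : ℕ) : K :=
  alpha n f₁ i / alpha n f₁ 0

/-- `b(1)_{i+2} = βᵢ` for `i ≥ 0`. -/
def b1 (n : ℕ) (f₂ : K[X]) : ℕ → K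
  | 0 => 0
  | 1 => 0
  | i + 2 => beta n f₂ i

/-- The numbers `b(k)_i`, for `k ≥ 1` and `i ≥ 2k`: those for `k = 1` are given by `b1`, and for
`k ≥ 2`, `b(k)_i = b(k-1)_i + c(1)_{k-1} b(1)_{i-k+1} - c(1)_{i-k} b(1)_k`.
(Only indices `k ≥ 1`, `i ≥ 2k` are used; for these no subtraction below truncates.) -/
def b (n : ℕ) (f₁ f₂ : K[X]) : ℕ → ℕ → K
  | 0, _ => 0
  | 1, i => b1 n f₂ i
  | k + 2, i => b n f₁ f₂ (k + 1) i
      + c1 n f₁ (k + 1) * b1 n f₂ (i - (k + 1)) - c1 n f₁ (i - (k + 2)) * b1 n f₂ (k + 2)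

/-- The shifted matrix `C(m)_i` of size `(m-1) × (m-1)`, `m ≥ 2`.  With rows and columns numbered
from `1`, its entry at `(r, s)` is `b(min r s)_{r+s}`, except in the last row `r = m - 1`, where it
is `b(s)_{m-1+s+i}`.  In particular `C(m)_0 = C(m)` is symmetric. -/
def CMat (n : ℕ) (f₁ f₂ : K[X]) (m i : ℕ) : Matrix (Fin (m - 1)) (Fin (m - 1)) K :=
  Matrix.of fun r s =>
    if (r : ℕ) + 1 = m - 1 then b n f₁ f₂ ((s : ℕ) + 1) ((m - 1) + ((s : ℕ) + 1) + i)
    else b n f₁ f₂ (min ((r : ℕ) + 1) ((s : ℕ) + 1)) (((r : ℕ) + 1) + ((s : ℕ) + 1))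

/-- `c(m)_i`, for `m ≥ 1`: it is `αᵢ / α₀` for `m = 1` and `det C(m)_i` for `m ≥ 2`.
The number `c(m)` is `c(m)_0`. -/
def c (n : ℕ) (f₁ f₂ : K[X]) (m i : ℕ) : K :=
  if m = 1 then c1 n f₁ i else (CMat n f₁ f₂ m i).det

/-- The modified normalisation: `γ̃₁ = α₀`, `γ̃₂ = 1`, and
`γ̃_{j+1} = γ̃_{j-1} c(j-1)² / c(j)²` for `j ≥ 2`.  (The value at the index `0` is not used.) -/
def gammaT (n : ℕ) (f₁ f₂ : K[X]) : ℕ → K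
  | 0 => 0
  | 1 => alpha n f₁ 0
  | 2 => 1
  | j + 3 => gammaT n f₁ f₂ (j + 1) * (c n f₁ f₂ (j + 1) 0 ^ 2 / c n f₁ f₂ (j + 2) 0 ^ 2)

end

end EuclidJacobi

/-!
Write `a_i = c(1)_i`, `b_i = b(1)_i`, and call `f̂₁ = f₁ / α₀` the monic multiple of `f₁`.  The
polynomials `R_s` given by `R_0 = 0` and `R_{s+1} = x R_s + a_s f₂ - b_{s+1} f̂₁` have degree at most
`n - 2`, and the recursion defining `b(k)_i` says exactly that the coefficient of `x^{n-1-ρ}` in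
`R_s` is `b(s)_{ρ+s}` (`coeff_bezoutRow`).  As `(r, s) ↦ b(s)_{r+s}` is symmetric
(`b_add_comm`; it is the Bezoutian matrix of `f₁` and `f₂`), the matrix `C(m)_i` consists of
coefficients of the `R_s` with `1 ≤ s ≤ m - 1`.  Expanding its determinant along the last row gives
`F_m := ∑_p c(m)_p x^{n-m-p} = ∑_s w_s R_s`, where the cofactors `w_s` do not depend on `p`
(`rowPoly_eq_sum_bezoutRow`).  Hence `F_m = u f₁ + v f₂` with `deg v ≤ m - 2`, and the coefficient of
`x^{m-2}` in `v` is `w_{m-1} = c(m-1)`.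

On the other side, the Euclidean algorithm gives `f_m = U f₁ + V f₂` with `U`, `V` coprime, and in
the absence of degree jumps `deg V = m - 2` with leading coefficient `α₀ / lc f_{m-1}`
(`exists_cofactors`).  Comparing degrees in `(u V - U v) f₁ = V F_m - v f_m` shows that `u V = U v`;
so `V ∣ v`, and the degrees force `F_m = (c(m-1) lc f_{m-1} / α₀) f_m`
(`eq_C_mul_of_degree_lt`, `rowPoly_eq_C_mul_remSeq`).  The theorem follows by induction on `m`, once
the recursion for `γ̃` is rewritten as `γ̃_m γ̃_{m+1} c(m)² = α₀` (`gammaT_mul_gammaT_succ`).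
-/

namespace EuclidJacobi

open Finset

variable {K : Type*} [Field K] {n : ℕ} {f₁ f₂ : K[X]}

/-! ### Coefficients and the Bezoutian -/

theorem alpha_zero_ne_zero (hf₁ : f₁.degree = ((n - 1 : ℕ) : WithBot ℕ)) : alpha n f₁ 0 ≠ 0 := by
  have h := coeff_ne_zero_of_eq_degree hf₁
  simpa [alpha] using h

theorem alpha_zero_eq_leadingCoeff (hf₁ : f₁.degree = ((n - 1 : ℕ) : WithBot ℕ)) :
    alpha n f₁ 0 = f₁.leadingCoeff := by
  simp [alpha, leadingCoeff, natDegree_eq_of_degree_eq_some hf₁]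

theorem c1_zero (hf₁ : f₁.degree = ((n - 1 : ℕ) : WithBot ℕ)) : c1 n f₁ 0 = 1 :=
  div_self (alpha_zero_ne_zero hf₁)

theorem c1_eq_zero {i : ℕ} (hi : n - 1 < i) : c1 n f₁ i = 0 := by
  rw [c1, alpha, if_neg (by omega), zero_div]

theorem b1_eq_zero (hn : 2 ≤ n) {i : ℕ} (hi : n < i) : b1 n f₂ i = 0 := by
  obtain ⟨i, rfl⟩ := Nat.exists_eq_add_of_le' (show 2 ≤ i by omega)
  rw [b1, beta, if_neg (by omega)]

theorem coeff_left (hf₁ : f₁.degree = ((n - 1 : ℕ) : WithBot ℕ)) {r : ℕ} (hr : r ≤ n - 1) :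
    f₁.coeff (n - 1 - r) = alpha n f₁ 0 * c1 n f₁ r := by
  rw [c1, mul_div_cancel₀ _ (alpha_zero_ne_zero hf₁), alpha, if_pos hr]

theorem coeff_right (hn : 2 ≤ n) (hf₂ : f₂.degree = ((n - 2 : ℕ) : WithBot ℕ)) {r : ℕ}
    (hr : r ≤ n - 1) : f₂.coeff (n - 1 - r) = b1 n f₂ (r + 1) := by
  cases r with
  | zero =>
    rw [b1]
    apply coeff_eq_zero_of_degree_lt
    rw [hf₂]
    exact_mod_cast (by omega : n - 2 < n - 1 - 0)
  | succ r =>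
    rw [b1, beta, if_pos (by omega)]
    congr 1
    omega

/-- The defining recursion of `b(k)_i` on antidiagonals; with `b(0) = 0` it also covers `k = 1`. -/
theorem b_succ (hf₁ : f₁.degree = ((n - 1 : ℕ) : WithBot ℕ)) (s r : ℕ) :
    b n f₁ f₂ (s + 1) (r + (s + 1)) = b n f₁ f₂ s (r + 1 + s)
      + c1 n f₁ s * b1 n f₂ (r + 1) - c1 n f₁ r * b1 n f₂ (s + 1) := by
  cases s with
  | zero => simp [b, b1, c1_zero hf₁]
  | succ s =>
    rw [b, show r + (s + 1 + 1) - (s + 1) = r + 1 by omega,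
      show r + (s + 1 + 1) - (s + 2) = r by omega,
      show r + (s + 1 + 1) = r + 1 + (s + 1) by omega]

/-- Moving both indices of `b(s)_{r+s}` by one towards the diagonal changes it and its transpose by
the same amount, so symmetry follows by induction on the distance from the diagonal. -/
theorem b_add_comm (hf₁ : f₁.degree = ((n - 1 : ℕ) : WithBot ℕ)) (r s : ℕ) :
    b n f₁ f₂ s (r + s) = b n f₁ f₂ r (s + r) := by
  have key : ∀ d r : ℕ, b n f₁ f₂ (r + d) (r + (r + d)) = b n f₁ f₂ r (r + d + r) := by
    intro d
    induction d using Nat.twoStepInduction with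
    | zero => intro r; rfl
    | one =>
      intro r
      rw [b_succ hf₁ r r]
      ring
    | more d ih _ =>
      intro r
      have h1 := b_succ (f₂ := f₂) hf₁ (r + d + 1) r
      have h2 := b_succ (f₂ := f₂) hf₁ r (r + d + 1)
      have h3 := ih (r + 1)
      rw [show r + 1 + d = r + d + 1 by omega] at h3
      rw [show r + (d + 2) = r + d + 1 + 1 by omega, h1, h3, h2]
      ring
  rcases le_total r s with h | h
  · obtain ⟨d, rfl⟩ := Nat.exists_eq_add_of_le h
    exact key d r
  · obtain ⟨d, rfl⟩ := Nat.exists_eq_add_of_le h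
    exact (key d s).symm

theorem b_self (hf₁ : f₁.degree = ((n - 1 : ℕ) : WithBot ℕ)) (s : ℕ) : b n f₁ f₂ s s = 0 := by
  simpa [b] using b_add_comm (f₂ := f₂) hf₁ 0 s

theorem b_eq_zero (hn : 2 ≤ n) (hf₁ : f₁.degree = ((n - 1 : ℕ) : WithBot ℕ)) (s : ℕ) {r : ℕ}
    (hr : n ≤ r) : b n f₁ f₂ s (r + s) = 0 := by
  induction s generalizing r with
  | zero => rfl
  | succ s ih =>
    rw [b_succ hf₁, ih (by omega), b1_eq_zero hn (i := r + 1) (by omega),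
      c1_eq_zero (i := r) (by omega)]
    ring

/-! ### The combinations of `f₁` and `f₂` whose coefficients are the `b(s)_i` -/

variable (n f₁ f₂) in
/-- The multiplier of `f₁` in `bezoutRow n f₁ f₂ s`. -/
noncomputable def leftMul : ℕ → K[X]
  | 0 => 0
  | s + 1 => X * leftMul s - C (b1 n f₂ (s + 1) / alpha n f₁ 0)

variable (n f₁) in
/-- The multiplier of `f₂` in `bezoutRow n f₁ f₂ s`: the polynomial
`x^{s-1} + c(1)_1 x^{s-2} + ⋯ + c(1)_{s-1}`. -/
noncomputable def rightMul : ℕ → K[X]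
  | 0 => 0
  | s + 1 => X * rightMul s + C (c1 n f₁ s)

variable (n f₁ f₂) in
/-- The polynomial `R_s` with `R_0 = 0` and `R_{s+1} = x R_s + c(1)_s f₂ - b(1)_{s+1} f₁ / α₀`,
given by its representation in terms of `f₁` and `f₂`. -/
noncomputable def bezoutRow (s : ℕ) : K[X] :=
  leftMul n f₁ f₂ s * f₁ + rightMul n f₁ s * f₂

theorem bezoutRow_succ (s : ℕ) : bezoutRow n f₁ f₂ (s + 1) =
    X * bezoutRow n f₁ f₂ s + C (c1 n f₁ s) * f₂ - C (b1 n f₂ (s + 1) / alpha n f₁ 0) * f₁ := by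
  simp only [bezoutRow, leftMul, rightMul]
  ring

theorem degree_rightMul_lt (s : ℕ) : (rightMul n f₁ s).degree < s := by
  induction s with
  | zero => simp [rightMul]
  | succ s ih =>
    rw [degree_lt_iff_coeff_zero] at ih ⊢
    intro t ht
    obtain ⟨t, rfl⟩ := Nat.exists_eq_add_of_le' (show 1 ≤ t by omega)
    rw [rightMul, coeff_add, coeff_X_mul, coeff_C_succ, add_zero]
    exact ih t (by omega)

theorem coeff_rightMul (hf₁ : f₁.degree = ((n - 1 : ℕ) : WithBot ℕ)) (s : ℕ) :
    (rightMul n f₁ (s + 1)).coeff s = 1 := by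
  induction s with
  | zero => simp [rightMul, c1_zero hf₁]
  | succ s ih => rw [rightMul, coeff_add, coeff_X_mul, coeff_C_succ, add_zero, ih]

theorem coeff_bezoutRow (hn : 2 ≤ n) (hf₁ : f₁.degree = ((n - 1 : ℕ) : WithBot ℕ))
    (hf₂ : f₂.degree = ((n - 2 : ℕ) : WithBot ℕ)) (s : ℕ) {r : ℕ} (hr : r ≤ n - 1) :
    (bezoutRow n f₁ f₂ s).coeff (n - 1 - r) = b n f₁ f₂ s (r + s) := by
  induction s generalizing r with
  | zero => simp [bezoutRow, leftMul, rightMul, b]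
  | succ s ih =>
    have hX : (X * bezoutRow n f₁ f₂ s).coeff (n - 1 - r) = b n f₁ f₂ s (r + 1 + s) := by
      rcases hr.lt_or_eq with h | h
      · rw [show n - 1 - r = n - 1 - (r + 1) + 1 by omega, coeff_X_mul, ih (by omega)]
      · rw [b_eq_zero hn hf₁ s (by omega), h, Nat.sub_self, coeff_X_mul_zero]
    rw [bezoutRow_succ, b_succ hf₁, coeff_sub, coeff_add, hX, coeff_C_mul, coeff_C_mul,
      coeff_left hf₁ hr, coeff_right hn hf₂ hr]
    field_simp [alpha_zero_ne_zero hf₁]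

theorem degree_bezoutRow_lt (hn : 2 ≤ n) (hf₁ : f₁.degree = ((n - 1 : ℕ) : WithBot ℕ))
    (hf₂ : f₂.degree = ((n - 2 : ℕ) : WithBot ℕ)) (s : ℕ) :
    (bezoutRow n f₁ f₂ s).degree < (n - 1 : ℕ) := by
  induction s with
  | zero => simp [bezoutRow, leftMul, rightMul]
  | succ s ih =>
    rw [degree_lt_iff_coeff_zero] at ih ⊢
    intro t ht
    rcases ht.eq_or_lt with rfl | ht
    · simpa [b_self hf₁] using coeff_bezoutRow hn hf₁ hf₂ (s + 1) (Nat.zero_le (n - 1))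
    · have h1 : f₁.coeff t = 0 := coeff_eq_zero_of_degree_lt (by rw [hf₁]; exact_mod_cast ht)
      have h2 : f₂.coeff t = 0 := coeff_eq_zero_of_degree_lt (by
        rw [hf₂]; exact_mod_cast (by omega : n - 2 < t))
      obtain ⟨t, rfl⟩ := Nat.exists_eq_add_of_le' (show 1 ≤ t by omega)
      rw [bezoutRow_succ, coeff_sub, coeff_add, coeff_X_mul, coeff_C_mul, coeff_C_mul, h1, h2,
        ih t (by omega)]
      ring

/-! ### Expansion of the determinants along the last row -/

variable (n f₁ f₂) in
/-- The matrix of size `m + 1` with the rows `(b(s)_{r+s})_s` for `r = 1, …, m`, followed by the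
row for `r = ρ`. -/
noncomputable def rowMat (m ρ : ℕ) : Matrix (Fin (m + 1)) (Fin (m + 1)) K :=
  Matrix.of fun r s => b n f₁ f₂ (s + 1)
    ((if r = Fin.last m then ρ else (r : ℕ) + 1) + (s + 1))

variable (n f₁ f₂) in
/-- The cofactors of the last row of `rowMat n f₁ f₂ m ρ`. -/
noncomputable def lastCofactor (m : ℕ) (s : Fin (m + 1)) : K :=
  (-1) ^ (m + (s : ℕ)) *
    (Matrix.of fun r t : Fin m =>
      b n f₁ f₂ (s.succAbove t + 1) (((r : ℕ) + 1) + (s.succAbove t + 1))).det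

theorem b_min (hf₁ : f₁.degree = ((n - 1 : ℕ) : WithBot ℕ)) (r s : ℕ) :
    b n f₁ f₂ (min r s) (r + s) = b n f₁ f₂ s (r + s) := by
  rcases le_total r s with h | h
  · rw [min_eq_left h, b_add_comm hf₁ r s, add_comm]
  · rw [min_eq_right h]

theorem c_add_two (hf₁ : f₁.degree = ((n - 1 : ℕ) : WithBot ℕ)) (m i : ℕ) :
    c n f₁ f₂ (m + 2) i = (rowMat n f₁ f₂ m (m + 1 + i)).det := by
  rw [c, if_neg (by omega)]
  congr 1
  ext r s
  simp only [CMat, rowMat, Matrix.of_apply]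
  by_cases hr : r = Fin.last m
  · subst hr
    rw [if_pos (by simp), if_pos rfl]
    congr 1
    omega
  · have : (r : ℕ) ≠ m := fun h => hr (Fin.ext h)
    rw [if_neg (by omega), if_neg hr, b_min hf₁]

theorem det_rowMat (m ρ : ℕ) : (rowMat n f₁ f₂ m ρ).det =
    ∑ s : Fin (m + 1), lastCofactor n f₁ f₂ m s * b n f₁ f₂ (s + 1) (ρ + (s + 1)) := by
  rw [Matrix.det_succ_row _ (Fin.last m)]
  refine Finset.sum_congr rfl fun s _ => ?_
  have h : (rowMat n f₁ f₂ m ρ).submatrix (Fin.last m).succAbove s.succAbove =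
      Matrix.of fun r t : Fin m =>
        b n f₁ f₂ (s.succAbove t + 1) (((r : ℕ) + 1) + (s.succAbove t + 1)) := by
    ext r t
    simp [rowMat, Fin.succAbove_last, (Fin.castSucc_lt_last r).ne]
  rw [h, lastCofactor, rowMat, Matrix.of_apply, if_pos rfl, Fin.val_last]
  ring

theorem det_rowMat_eq_zero {m ρ : ℕ} (h1 : 1 ≤ ρ) (hm : ρ ≤ m) :
    (rowMat n f₁ f₂ m ρ).det = 0 := by
  have hne : (⟨ρ - 1, by omega⟩ : Fin (m + 1)) ≠ Fin.last m := by
    intro h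
    have := congrArg Fin.val h
    simp at this
    omega
  refine Matrix.det_zero_of_row_eq hne (funext fun s => ?_)
  simp only [rowMat, Matrix.of_apply, if_neg hne, if_pos]
  congr 2
  omega

theorem lastCofactor_last (hf₁ : f₁.degree = ((n - 1 : ℕ) : WithBot ℕ)) (m : ℕ) :
    lastCofactor n f₁ f₂ m (Fin.last m) = c n f₁ f₂ (m + 1) 0 := by
  rw [lastCofactor, Fin.val_last, Even.neg_one_pow ⟨m, rfl⟩, one_mul]
  cases m with
  | zero => simp [c, c1_zero hf₁]
  | succ m =>
    rw [c_add_two hf₁]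
    congr 1
    ext r t
    simp only [rowMat, Matrix.of_apply, Fin.succAbove_last, Fin.val_castSucc]
    congr 2
    split_ifs with h
    · simp [h]
    · rfl

variable (n f₁ f₂) in
/-- The polynomial `∑_p c(m)_p x^{n-m-p}`, to be compared with `f_m`. -/
noncomputable def rowPoly (m : ℕ) : K[X] :=
  ∑ p ∈ Finset.range (n - m + 1), C (c n f₁ f₂ m p) * X ^ (n - m - p)

theorem coeff_rowPoly (m t : ℕ) : (rowPoly n f₁ f₂ m).coeff t =
    if t ≤ n - m then c n f₁ f₂ m (n - m - t) else 0 := by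
  simp only [rowPoly, finsetSum_coeff, coeff_C_mul, coeff_X_pow]
  split_ifs with h
  · rw [Finset.sum_eq_single (n - m - t)]
    · rw [if_pos (by omega), mul_one]
    · intro p hp hpt
      rw [Finset.mem_range] at hp
      rw [if_neg (by omega), mul_zero]
    · intro hp
      rw [Finset.mem_range] at hp
      omega
  · refine Finset.sum_eq_zero fun p _ => ?_
    rw [if_neg (by omega), mul_zero]

theorem degree_rowPoly_le (m : ℕ) : (rowPoly n f₁ f₂ m).degree ≤ (n - m : ℕ) := by
  rw [degree_le_iff_coeff_zero]
  intro t ht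
  rw [coeff_rowPoly, if_neg (not_le.mpr (by exact_mod_cast ht))]

theorem rowPoly_eq_sum_bezoutRow (hn : 2 ≤ n) (hf₁ : f₁.degree = ((n - 1 : ℕ) : WithBot ℕ))
    (hf₂ : f₂.degree = ((n - 2 : ℕ) : WithBot ℕ)) {m : ℕ} (hm : m + 2 ≤ n) :
    rowPoly n f₁ f₂ (m + 2) =
      ∑ s : Fin (m + 1), C (lastCofactor n f₁ f₂ m s) * bezoutRow n f₁ f₂ (s + 1) := by
  ext t
  simp only [coeff_rowPoly, finsetSum_coeff, coeff_C_mul]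
  rcases lt_or_ge t (n - 1) with ht | ht
  · -- The coefficient of `x^{n-1-ρ}` on the right-hand side is the determinant of `rowMat m ρ`.
    obtain ⟨ρ, hρ, rfl⟩ : ∃ ρ, ρ ≤ n - 1 ∧ t = n - 1 - ρ := ⟨n - 1 - t, by omega, by omega⟩
    simp only [coeff_bezoutRow hn hf₁ hf₂ _ hρ]
    rw [← det_rowMat]
    split_ifs with h
    · rw [c_add_two hf₁]
      congr 2
      omega
    · rw [det_rowMat_eq_zero (by omega) (by omega)]
  · rw [if_neg (by omega)]
    refine (Finset.sum_eq_zero fun s _ => ?_).symm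
    rw [(degree_lt_iff_coeff_zero _ _).1 (degree_bezoutRow_lt hn hf₁ hf₂ _) t ht, mul_zero]

theorem exists_rowPoly_eq (hn : 2 ≤ n) (hf₁ : f₁.degree = ((n - 1 : ℕ) : WithBot ℕ))
    (hf₂ : f₂.degree = ((n - 2 : ℕ) : WithBot ℕ)) {m : ℕ} (hm : m + 2 ≤ n) :
    ∃ u v : K[X], rowPoly n f₁ f₂ (m + 2) = u * f₁ + v * f₂ ∧ v.degree ≤ m ∧
      v.coeff m = c n f₁ f₂ (m + 1) 0 := by
  refine ⟨∑ s : Fin (m + 1), C (lastCofactor n f₁ f₂ m s) * leftMul n f₁ f₂ (s + 1),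
    ∑ s : Fin (m + 1), C (lastCofactor n f₁ f₂ m s) * rightMul n f₁ (s + 1), ?_, ?_, ?_⟩
  · rw [rowPoly_eq_sum_bezoutRow hn hf₁ hf₂ hm, Finset.sum_mul, Finset.sum_mul,
      ← Finset.sum_add_distrib]
    refine Finset.sum_congr rfl fun s _ => ?_
    rw [bezoutRow]
    ring
  · rw [degree_le_iff_coeff_zero]
    intro t ht
    have ht : m < t := by exact_mod_cast ht
    simp only [finsetSum_coeff, coeff_C_mul]
    refine Finset.sum_eq_zero fun s _ => ?_
    rw [(degree_lt_iff_coeff_zero _ _).1 (degree_rightMul_lt _) t (by omega), mul_zero]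
  · -- Only the multiplier of index `m + 1` reaches the degree `m`.
    simp only [finsetSum_coeff, coeff_C_mul]
    rw [Fin.sum_univ_castSucc, Finset.sum_eq_zero fun s _ => ?_, zero_add, Fin.val_last,
      coeff_rightMul hf₁, mul_one, lastCofactor_last hf₁]
    rw [(degree_lt_iff_coeff_zero _ _).1 (degree_rightMul_lt _) m (by simp), mul_zero]

/-! ### The signed Euclidean algorithm without degree jumps -/

theorem remSeq_succ_eq_zero {i : ℕ} (hi : 2 ≤ i) (h : remSeq f₁ f₂ i = 0) :
    remSeq f₁ f₂ (i + 1) = 0 := by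
  obtain ⟨i, rfl⟩ := Nat.exists_eq_add_of_le' hi
  rw [remSeq, if_pos h]

theorem remSeq_ne_zero (hf₁ : f₁ ≠ 0) {i j : ℕ} (hi : 1 ≤ i) (hij : i ≤ j)
    (hj : remSeq f₁ f₂ j ≠ 0) : remSeq f₁ f₂ i ≠ 0 := by
  rcases hi.eq_or_lt with rfl | hi
  · simpa [remSeq] using hf₁
  · intro h
    refine hj ?_
    induction j, hij using Nat.le_induction with
    | base => exact h
    | succ k hk ih =>
      by_contra hne
      exact hne (remSeq_succ_eq_zero (by omega) (by_contra fun h' => h' (ih h')))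

theorem degree_remSeq (hn : 2 ≤ n) (hf₁ : f₁.degree = ((n - 1 : ℕ) : WithBot ℕ))
    (hf₂ : f₂.degree = ((n - 2 : ℕ) : WithBot ℕ)) {j : ℕ} (hjn : j ≤ n)
    (hdeg : (remSeq f₁ f₂ j).degree = ((n - j : ℕ) : WithBot ℕ)) {i : ℕ} (hi : 1 ≤ i)
    (hij : i ≤ j) : (remSeq f₁ f₂ i).degree = ((n - i : ℕ) : WithBot ℕ) := by
  have hf₁0 : f₁ ≠ 0 := by rintro rfl; simp at hf₁
  have hj0 : remSeq f₁ f₂ j ≠ 0 := by intro h; simp [h] at hdeg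
  have hne : ∀ k, 1 ≤ k → k ≤ j → remSeq f₁ f₂ k ≠ 0 := fun k h1 h2 =>
    remSeq_ne_zero hf₁0 h1 h2 hj0
  have hlt : ∀ k, 1 ≤ k → k + 1 ≤ j →
      (remSeq f₁ f₂ (k + 1)).natDegree < (remSeq f₁ f₂ k).natDegree := by
    intro k h1 h2
    rcases h1.eq_or_lt with rfl | h1
    · rw [remSeq, remSeq, natDegree_eq_of_degree_eq_some hf₁, natDegree_eq_of_degree_eq_some hf₂]
      omega
    · obtain ⟨k, rfl⟩ := Nat.exists_eq_add_of_le' (show 2 ≤ k by omega)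
      exact natDegree_lt_natDegree (hne _ (by omega) h2)
        (remSeq_spec f₁ f₂ k (hne _ (by omega) (by omega))).2
  -- A strictly decreasing sequence of degrees from `n - 1` down to `n - j` in `j - 1` steps
  -- decreases by exactly one in each step.
  have hle : ∀ k, 1 ≤ k → k ≤ j → (remSeq f₁ f₂ k).natDegree + k ≤ n := by
    intro k h1
    induction k, h1 using Nat.le_induction with
    | base =>
      intro _
      rw [remSeq, natDegree_eq_of_degree_eq_some hf₁]
      omega
    | succ k h1 ih =>
      intro h2
      have := ih (by omega)
      have := hlt k h1 h2
      omega
  have hge : ∀ d k, 1 ≤ k → k + d = j → n ≤ (remSeq f₁ f₂ k).natDegree + k := by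
    intro d
    induction d with
    | zero =>
      rintro k - rfl
      have := natDegree_eq_of_degree_eq_some hdeg
      simp only [add_zero] at this
      omega
    | succ d ih =>
      intro k h1 h2
      have := ih (k + 1) (by omega) (by omega)
      have := hlt k h1 (by omega)
      omega
  rw [degree_eq_natDegree (hne i hi hij)]
  have h1 := hle i hi hij
  have h2 := hge (j - i) i hi (by omega)
  congr 1
  omega

/-- The cofactors of two consecutive terms of the Euclidean algorithm.  Their determinant is an
invariant of the recursion, and the multipliers of `f₂` have leading coefficients that telescope. -/
theorem exists_cofactors (hn : 2 ≤ n) (hf₁ : f₁.degree = ((n - 1 : ℕ) : WithBot ℕ))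
    (hf₂ : f₂.degree = ((n - 2 : ℕ) : WithBot ℕ)) {j : ℕ} (hjn : j ≤ n)
    (hdeg : (remSeq f₁ f₂ j).degree = ((n - j : ℕ) : WithBot ℕ)) (m : ℕ) (hm : m + 2 ≤ j) :
    ∃ U V U' V' : K[X], remSeq f₁ f₂ (m + 1) = U * f₁ + V * f₂ ∧
      remSeq f₁ f₂ (m + 2) = U' * f₁ + V' * f₂ ∧ U * V' - U' * V = 1 ∧
      V.degree < V'.degree ∧ V'.degree = m ∧
      V'.leadingCoeff * (remSeq f₁ f₂ (m + 1)).leadingCoeff = f₁.leadingCoeff := by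
  induction m with
  | zero => exact ⟨1, 0, 0, 1, by simp [remSeq], by simp [remSeq], by simp, by simp, by simp,
      by simp [remSeq]⟩
  | succ m ih =>
    obtain ⟨U, V, U', V', h, h', hdet, hVV', hV', hlc⟩ := ih (by omega)
    have d1 := degree_remSeq hn hf₁ hf₂ hjn hdeg (i := m + 1) (by omega) (by omega)
    have d2 := degree_remSeq hn hf₁ hf₂ hjn hdeg (i := m + 2) (by omega) (by omega)
    have hne2 : remSeq f₁ f₂ (m + 2) ≠ 0 := by intro h; simp [h] at d2
    obtain ⟨⟨q, hq⟩, hlt⟩ := remSeq_spec f₁ f₂ m hne2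
    have hlt' : (remSeq f₁ f₂ (m + 3)).degree < (remSeq f₁ f₂ (m + 1)).degree := by
      refine hlt.trans ?_
      rw [d1, d2]
      exact_mod_cast (by omega : n - (m + 2) < n - (m + 1))
    have hmul : q * remSeq f₁ f₂ (m + 2) = remSeq f₁ f₂ (m + 1) + remSeq f₁ f₂ (m + 3) := by
      rw [hq]; ring
    have hqlc : q.leadingCoeff * (remSeq f₁ f₂ (m + 2)).leadingCoeff =
        (remSeq f₁ f₂ (m + 1)).leadingCoeff := by
      rw [← leadingCoeff_mul, hmul, leadingCoeff_add_of_degree_lt' hlt']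
    have hq0 : q ≠ 0 := by
      rintro rfl
      rw [zero_mul] at hmul
      have := degree_add_eq_left_of_degree_lt hlt'
      rw [← hmul, d1] at this
      simp at this
    have hqdeg : q.degree = 1 := by
      have := degree_add_eq_left_of_degree_lt hlt'
      rw [← hmul, degree_mul, d1, d2, degree_eq_natDegree hq0] at this
      have : q.natDegree + (n - (m + 2)) = n - (m + 1) := by exact_mod_cast this
      rw [degree_eq_natDegree hq0, show q.natDegree = 1 by omega]
      rfl
    have hqV' : (q * V').degree = (m + 1 : ℕ) := by
      rw [degree_mul, hqdeg, hV', add_comm]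
      rfl
    have hVq : V.degree < (q * V').degree := by
      rw [hqV']
      refine hVV'.trans ?_
      rw [hV']
      exact_mod_cast Nat.lt_succ_self m
    refine ⟨U', V', q * U' - U, q * V' - V, h', ?_, ?_, ?_, ?_, ?_⟩
    · rw [show remSeq f₁ f₂ (m + 1 + 2) = q * remSeq f₁ f₂ (m + 2) - remSeq f₁ f₂ (m + 1) by
        rw [hmul]; ring, h, h']
      ring
    · rw [← hdet]; ring
    · rw [degree_sub_eq_left_of_degree_lt hVq, hqV', hV']
      exact_mod_cast Nat.lt_succ_self m
    · rw [degree_sub_eq_left_of_degree_lt hVq, hqV']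
    · rw [leadingCoeff_sub_of_degree_lt hVq, leadingCoeff_mul, ← hlc, ← hqlc]
      ring

/-- Two combinations `F` and `f` of `f₁` and `f₂` are proportional if `f` has coprime multipliers
`U`, `V`, the multiplier `v` in `F` has degree at most `deg V`, and all degrees are small compared
with `f₁`. -/
theorem eq_C_mul_of_degree_lt {g₁ g₂ F f u v U V : K[X]} (hF : F = u * g₁ + v * g₂)
    (hf : f = U * g₁ + V * g₂) (hco : IsCoprime U V) (hV : V ≠ 0) (hv : v.degree ≤ V.degree)
    (h1 : (V * F).degree < g₁.degree) (h2 : (v * f).degree < g₁.degree) :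
    F = C (v.coeff V.natDegree / V.leadingCoeff) * f := by
  have hid : (u * V - U * v) * g₁ = V * F - v * f := by rw [hF, hf]; ring
  have h0 : u * V - U * v = 0 := by
    by_contra hne
    have hlt : ((u * V - U * v) * g₁).degree < g₁.degree := by
      rw [hid]
      exact (degree_sub_le _ _).trans_lt (max_lt h1 h2)
    rw [degree_mul, degree_eq_natDegree hne] at hlt
    have hg : g₁ ≠ 0 := by rintro rfl; simp at h1
    rw [degree_eq_natDegree hg] at hlt
    have : (u * V - U * v).natDegree + g₁.natDegree < g₁.natDegree := by exact_mod_cast hlt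
    omega
  have hdvd : V ∣ v := hco.symm.dvd_of_dvd_mul_left ⟨u, by linear_combination -h0⟩
  obtain ⟨w, rfl⟩ := hdvd
  obtain ⟨k, rfl⟩ : ∃ k, w = C k := by
    rcases eq_or_ne w 0 with rfl | hw
    · exact ⟨0, by simp⟩
    · refine ⟨_, eq_C_of_natDegree_eq_zero ?_⟩
      rw [degree_mul, degree_eq_natDegree hV, degree_eq_natDegree hw] at hv
      have : V.natDegree + w.natDegree ≤ V.natDegree := by exact_mod_cast hv
      omega
  have hu : u = U * C k := mul_right_cancel₀ hV (by linear_combination h0)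
  rw [coeff_mul_C, coeff_natDegree, mul_div_cancel_left₀ _ (leadingCoeff_ne_zero.mpr hV), hF, hf,
    hu]
  ring

theorem rowPoly_eq_C_mul_remSeq (hn : 2 ≤ n) (hf₁ : f₁.degree = ((n - 1 : ℕ) : WithBot ℕ))
    (hf₂ : f₂.degree = ((n - 2 : ℕ) : WithBot ℕ)) {j : ℕ} (hjn : j ≤ n)
    (hdeg : (remSeq f₁ f₂ j).degree = ((n - j : ℕ) : WithBot ℕ)) {m : ℕ} (hm : m + 2 ≤ j) :
    rowPoly n f₁ f₂ (m + 2) =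
      C (c n f₁ f₂ (m + 1) 0 * (remSeq f₁ f₂ (m + 1)).leadingCoeff / alpha n f₁ 0) *
        remSeq f₁ f₂ (m + 2) := by
  obtain ⟨u, v, hF, hv, hvc⟩ := exists_rowPoly_eq hn hf₁ hf₂ (m := m) (by omega)
  obtain ⟨U, V, U', V', -, h', hdet, -, hV', hlc⟩ :=
    exists_cofactors hn hf₁ hf₂ hjn hdeg m hm
  have hV0 : V' ≠ 0 := by rintro rfl; simp at hV'
  have d2 := degree_remSeq hn hf₁ hf₂ hjn hdeg (i := m + 2) (by omega) hm
  have hlt : ((m : WithBot ℕ) + ((n - (m + 2) : ℕ) : WithBot ℕ)) < f₁.degree := by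
    rw [hf₁]
    exact_mod_cast (by omega : m + (n - (m + 2)) < n - 1)
  have key := eq_C_mul_of_degree_lt hF h'
    ⟨-V, U, by linear_combination hdet⟩ hV0 (by rw [hV']; exact hv)
    ((degree_mul_le _ _).trans_lt ((add_le_add hV'.le (degree_rowPoly_le _)).trans_lt hlt))
    ((degree_mul_le _ _).trans_lt ((add_le_add hv d2.le).trans_lt hlt))
  rw [key, natDegree_eq_of_degree_eq_some hV', hvc, alpha_zero_eq_leadingCoeff hf₁, ← hlc]
  have hV'l : V'.leadingCoeff ≠ 0 := leadingCoeff_ne_zero.mpr hV0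
  have hl : (remSeq f₁ f₂ (m + 1)).leadingCoeff ≠ 0 := by
    intro h
    rw [h, mul_zero, eq_comm, ← alpha_zero_eq_leadingCoeff hf₁] at hlc
    exact alpha_zero_ne_zero hf₁ hlc
  congr 2
  field_simp

/-! ### The normalising factors -/

theorem gammaT_mul_gammaT_succ (hf₁ : f₁.degree = ((n - 1 : ℕ) : WithBot ℕ)) (m : ℕ)
    (hc : ∀ i, 1 ≤ i → i ≤ m + 1 → c n f₁ f₂ i 0 ≠ 0) :
    gammaT n f₁ f₂ (m + 1) * gammaT n f₁ f₂ (m + 2) * c n f₁ f₂ (m + 1) 0 ^ 2 =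
      alpha n f₁ 0 := by
  induction m with
  | zero => simp [gammaT, c, c1_zero hf₁]
  | succ m ih =>
    rw [← ih fun i h1 h2 => hc i h1 (by omega)]
    have h := hc (m + 2) (by omega) (by omega)
    rw [show gammaT n f₁ f₂ (m + 1 + 2) = gammaT n f₁ f₂ (m + 1) *
      (c n f₁ f₂ (m + 1) 0 ^ 2 / c n f₁ f₂ (m + 2) 0 ^ 2) from rfl]
    field_simp

theorem remSeq_one_eq (hf₁ : f₁.degree = ((n - 1 : ℕ) : WithBot ℕ)) :
    remSeq f₁ f₂ 1 = C (gammaT n f₁ f₂ 1) * rowPoly n f₁ f₂ 1 := by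
  ext t
  rw [coeff_C_mul, coeff_rowPoly, remSeq, gammaT]
  split_ifs with h
  · rw [c, if_pos rfl, ← coeff_left hf₁ (by omega)]
    congr 1
    omega
  · rw [mul_zero]
    apply coeff_eq_zero_of_degree_lt
    rw [hf₁]
    exact_mod_cast not_le.mp h

theorem leadingCoeff_of_eq_C_mul_rowPoly {f : K[X]} {m : ℕ} {g : K}
    (hd : f.degree = ((n - m : ℕ) : WithBot ℕ)) (h : f = C g * rowPoly n f₁ f₂ m) :
    f.leadingCoeff = g * c n f₁ f₂ m 0 := by
  rw [leadingCoeff, natDegree_eq_of_degree_eq_some hd, h, coeff_C_mul, coeff_rowPoly, if_pos le_rfl,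
    Nat.sub_self]

theorem c_ne_zero_and_remSeq_eq (hn : 2 ≤ n) (hf₁ : f₁.degree = ((n - 1 : ℕ) : WithBot ℕ))
    (hf₂ : f₂.degree = ((n - 2 : ℕ) : WithBot ℕ)) {j : ℕ} (hjn : j ≤ n)
    (hdeg : (remSeq f₁ f₂ j).degree = ((n - j : ℕ) : WithBot ℕ)) (m : ℕ) (hm : m + 1 ≤ j) :
    c n f₁ f₂ (m + 1) 0 ≠ 0 ∧
      remSeq f₁ f₂ (m + 1) = C (gammaT n f₁ f₂ (m + 1)) * rowPoly n f₁ f₂ (m + 1) := by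
  induction m using Nat.strong_induction_on with
  | _ m ih =>
    cases m with
    | zero => exact ⟨by simp [c, c1_zero hf₁], remSeq_one_eq hf₁⟩
    | succ m =>
      have hc : ∀ i, 1 ≤ i → i ≤ m + 1 → c n f₁ f₂ i 0 ≠ 0 := by
        intro i h1 h2
        obtain ⟨i, rfl⟩ := Nat.exists_eq_add_of_le' h1
        exact (ih i (by omega) (by omega)).1
      have hγ := gammaT_mul_gammaT_succ hf₁ m hc
      have hα := alpha_zero_ne_zero hf₁
      have d1 := degree_remSeq hn hf₁ hf₂ hjn hdeg (i := m + 1) (by omega) (by omega)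
      have hlc := leadingCoeff_of_eq_C_mul_rowPoly d1 (ih m (by omega) (by omega)).2
      have hF := rowPoly_eq_C_mul_remSeq hn hf₁ hf₂ hjn hdeg hm
      -- The factor between `f_{m+2}` and `rowPoly (m + 2)` is the inverse of `γ̃_{m+2}`.
      have hinv : gammaT n f₁ f₂ (m + 2) *
          (c n f₁ f₂ (m + 1) 0 * (remSeq f₁ f₂ (m + 1)).leadingCoeff / alpha n f₁ 0) = 1 := by
        rw [hlc, mul_div_assoc', div_eq_one_iff_eq hα, ← hγ]
        ring
      have hf : remSeq f₁ f₂ (m + 2) =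
          C (gammaT n f₁ f₂ (m + 2)) * rowPoly n f₁ f₂ (m + 2) := by
        rw [hF, ← mul_assoc, ← C_mul, hinv, C_1, one_mul]
      refine ⟨fun h0 => ?_, hf⟩
      have d2 := degree_remSeq hn hf₁ hf₂ hjn hdeg (i := m + 2) (by omega) hm
      have hlc2 := leadingCoeff_of_eq_C_mul_rowPoly d2 hf
      rw [h0, mul_zero, leadingCoeff_eq_zero] at hlc2
      simp [hlc2] at d2

end EuclidJacobi

theorem mainTheorem2 {K : Type*} [Field K] [CharZero K] (n : ℕ) (hn : 2 ≤ n)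
    (f₁ f₂ : Polynomial K)
    (hf₁ : f₁.degree = ((n - 1 : ℕ) : WithBot ℕ)) (hf₂ : f₂.degree = ((n - 2 : ℕ) : WithBot ℕ))
    (j : ℕ) (hj1 : 1 ≤ j) (hjn : j ≤ n)
    (hdeg : (EuclidJacobi.remSeq f₁ f₂ j).degree = ((n - j : ℕ) : WithBot ℕ)) :
    ∀ i : ℕ, 1 ≤ i → i ≤ j →
      (EuclidJacobi.remSeq f₁ f₂ i).degree = ((n - i : ℕ) : WithBot ℕ) ∧
      EuclidJacobi.c n f₁ f₂ i 0 ≠ 0 ∧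
      EuclidJacobi.remSeq f₁ f₂ i =
        Polynomial.C (EuclidJacobi.gammaT n f₁ f₂ i) *
          ∑ p ∈ Finset.range (n - i + 1),
            Polynomial.C (EuclidJacobi.c n f₁ f₂ i p) * Polynomial.X ^ (n - i - p) ∧
      (EuclidJacobi.remSeq f₁ f₂ i).leadingCoeff =
        EuclidJacobi.gammaT n f₁ f₂ i * EuclidJacobi.c n f₁ f₂ i 0 := by
  intro i hi hij
  have hd := EuclidJacobi.degree_remSeq hn hf₁ hf₂ hjn hdeg hi hij
  obtain ⟨m, rfl⟩ := Nat.exists_eq_add_of_le' hi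
  obtain ⟨hc, hf⟩ := EuclidJacobi.c_ne_zero_and_remSeq_eq hn hf₁ hf₂ hjn hdeg m hij
  exact ⟨hd, hc, hf, EuclidJacobi.leadingCoeff_of_eq_C_mul_rowPoly hd hf⟩
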